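/- Let $K/k$ be a finite Galois extension of CM number fields (a CM number field being a totally complex quadratic extension of its maximal totally real subfield), with group $G=\mathrm{Gal}(K/k)$; then $K=K_+k$ and $K_+/k_+$ is Galois of the same degree, where $K_+$, $k_+$ are the maximal real subfields. Let $\tau$ denote complex conjugation. Suppose that every prime ideal $\mathfrak p$ of $k$ that is ramified in $K/k$ is not split in $k/k_+$, i.e. $\tau(\mathfrak p)=\mathfrak p$ (this holds in particular if $K/k$ is unramified). Let $\mathrm{Cap}_{K/k}$ be the kernel of the extension map $\mathrm{Cl}_k\to \mathrm{Cl}_K$ between ideal class groups, let $\widehat{\mathrm{Cap}}_{K/k}$ be its subgroup of classes of odd order, and let $$\widehat{\mathrm{Cap}}{}_{K/k}^{\,-}=\tfrac{1-\tau}{2}\,\widehat{\mathrm{Cap}}_{K/k}=\{c\in\widehat{\mathrm{Cap}}_{K/k} : \tau(c)=c^{-1}\}$$ be its imaginary (minus) component. Let $\hat\mu_K$ be the group of roots of unity of odd order in $K$. Then there is an isomorphism of groups $$\widehat{\mathrm{Cap}}{}_{K/k}^{\,-}\;\simeq\; H^1(G,\hat\mu_K).$$ Moreover it can be chosen as the usual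 map attached to capitulation: every class $c$ in $\widehat{\mathrm{Cap}}{}_{K/k}^{\,-}$ contains a nonzero integral ideal $\mathfrak a$ for which $\mathfrak a\mathcal O_K$ has a generator $\beta$ such that $\sigma(\beta)/\beta\in\hat\mu_K$ for all $\sigma\in G$ and the image of $c$ is the class of the cocycle $\sigma\mapsto\sigma(\beta)/\beta$. -/

import Mathlib

open NumberField NumberField.IsCMField
open scoped nonZeroDivisors

noncomputable section

namespace Capitulation

/-- The subgroup of the elements of odd (finite) order of a commutative group. An element of
infinite order has `orderOf = 0`, which is even. -/
def oddPart (M : Type*) [CommGroup M] : Subgroup M where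
  carrier := {x | Odd (orderOf x)}
  one_mem' := by simp
  mul_mem' := fun {x y} hx hy =>
    (hx.mul hy).of_dvd_nat ((Commute.all x y).orderOf_mul_dvd_mul_orderOf)
  inv_mem' := by simp

theorem mem_oddPart {M : Type*} [CommGroup M] {x : M} : x ∈ oddPart M ↔ Odd (orderOf x) :=
  Iff.rfl

/-- The action of `G` on the elements of odd order, restricted from the action on `M`. -/
instance oddPartAction (G M : Type*) [Group G] [CommGroup M] [MulDistribMulAction G M] :
    MulDistribMulAction G (oddPart M) where
  smul g x := ⟨g • (x : M), x.2.of_dvd_nat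
    (orderOf_map_dvd (MulDistribMulAction.toMonoidHom M g) (x : M))⟩
  one_smul x := Subtype.ext (one_smul G (x : M))
  mul_smul g h x := Subtype.ext (mul_smul g h (x : M))
  smul_mul g x y := Subtype.ext (smul_mul' g (x : M) (y : M))
  smul_one g := Subtype.ext (smul_one g)

/-- `ClassGroup.mulEquiv g` sends the class of `I` to the class of `g(I)`. -/
theorem mulEquiv_mk0 {R : Type*} [CommRing R] [IsDedekindDomain R] (g : R ≃+* R)
    (I J : (Ideal R)⁰) (hJ : (J : Ideal R) = (I : Ideal R).map g) :
    ClassGroup.mulEquiv g (ClassGroup.mk0 I) = ClassGroup.mk0 J := by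
  apply (ClassGroup.equiv (FractionRing R)).injective
  rw [ClassGroup.mulEquiv]
  simp only [MulEquiv.trans_apply, MulEquiv.apply_symm_apply, ClassGroup.equiv_mk0]
  refine congrArg (QuotientGroup.mk' _) (Units.ext ?_)
  ext x
  change (∃ y : FractionRing R, y ∈ ((I : Ideal R) : FractionalIdeal R⁰ (FractionRing R)) ∧
    IsFractionRing.ringEquivOfRingEquiv g y = x) ↔
    x ∈ ((J : Ideal R) : FractionalIdeal R⁰ (FractionRing R))
  simp only [FractionalIdeal.mem_coeIdeal, hJ]
  constructor
  · rintro ⟨y, ⟨r, hr, rfl⟩, rfl⟩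
    exact ⟨g r, Ideal.mem_map_of_mem g hr, by simp⟩
  · rintro ⟨s, hs, rfl⟩
    obtain ⟨r, hr, rfl⟩ := (Ideal.mem_map_of_equiv g s).mp hs
    exact ⟨_, ⟨r, hr, rfl⟩, by simp⟩

/-- The action of complex conjugation on the class group of a CM number field. -/
def classConj (k : Type*) [Field k] [NumberField k] [IsCMField k] :
    ClassGroup (𝓞 k) ≃* ClassGroup (𝓞 k) :=
  ClassGroup.mulEquiv (ringOfIntegersComplexConj k).toRingEquiv

theorem classConj_classConj (k : Type*) [Field k] [NumberField k] [IsCMField k]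
    (x : ClassGroup (𝓞 k)) : classConj k (classConj k x) = x := by
  obtain ⟨I, rfl⟩ := ClassGroup.mk0_surjective x
  have hI : (I : Ideal (𝓞 k)).map (ringOfIntegersComplexConj k).toRingEquiv ∈
      (Ideal (𝓞 k))⁰ := by
    rw [mem_nonZeroDivisors_iff_ne_zero]
    exact (Ideal.map_eq_bot_iff_of_injective (RingEquiv.injective _)).not.mpr
      (nonZeroDivisors.ne_zero I.2)
  rw [classConj, mulEquiv_mk0 _ I ⟨_, hI⟩ rfl, mulEquiv_mk0 _ _ I]
  refine le_antisymm (fun y hy => ?_) ?_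
  · have := Ideal.mem_map_of_mem (ringOfIntegersComplexConj k).toRingEquiv
      (Ideal.mem_map_of_mem (ringOfIntegersComplexConj k).toRingEquiv hy)
    have h : (ringOfIntegersComplexConj k).toRingEquiv
      ((ringOfIntegersComplexConj k).toRingEquiv y) = y := RingOfIntegers.ext (by simp)
    rwa [h] at this
  · rw [Ideal.map_le_iff_le_comap, Ideal.map_le_iff_le_comap]
    intro y hy
    have h : (ringOfIntegersComplexConj k).toRingEquiv
      ((ringOfIntegersComplexConj k).toRingEquiv y) = y := RingOfIntegers.ext (by simp)
    rw [Ideal.mem_comap, Ideal.mem_comap, h]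
    exact hy

/-- The group of the ideal classes of `k` that become trivial in `K`. -/
def cap (k K : Type*) [Field k] [NumberField k] [Field K] [NumberField K] [Algebra k K] :
    Subgroup (ClassGroup (𝓞 k)) :=
  (ClassGroup.extendedHom (𝓞 k) (𝓞 K)).ker

/-- The imaginary component of the odd part of the capitulation group: the classes of odd order
that capitulate in `K` and that complex conjugation sends to their inverse. As squaring is
bijective on elements of odd order, this is the image of the idempotent `(1 - τ) / 2`
(see `mem_oddCapMinus_iff`). -/
def oddCapMinus (k K : Type*) [Field k] [NumberField k] [IsCMField k] [Field K] [NumberField K]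
    [Algebra k K] : Subgroup (ClassGroup (𝓞 k)) where
  carrier := {c | c ∈ cap k K ∧ c ∈ oddPart (ClassGroup (𝓞 k)) ∧ classConj k c = c⁻¹}
  one_mem' := ⟨one_mem _, one_mem _, by simp⟩
  mul_mem' := fun {a b} ha hb => ⟨mul_mem ha.1 hb.1, mul_mem ha.2.1 hb.2.1, by
    rw [map_mul, ha.2.2, hb.2.2, mul_inv]⟩
  inv_mem' := fun {a} ha => ⟨inv_mem ha.1, inv_mem ha.2.1, by rw [map_inv, ha.2.2]⟩

/-- The imaginary component is the set of the classes `((1 - τ) / 2) d`, where `d` runs through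
the capitulating classes of odd order. -/
theorem mem_oddCapMinus_iff (k K : Type*) [Field k] [NumberField k] [IsCMField k] [Field K]
    [NumberField K] [Algebra k K] (c : ClassGroup (𝓞 k)) :
    c ∈ oddCapMinus k K ↔ (c ∈ cap k K ∧ c ∈ oddPart (ClassGroup (𝓞 k))) ∧
      ∃ d, (d ∈ cap k K ∧ d ∈ oddPart (ClassGroup (𝓞 k))) ∧ c ^ 2 = d * (classConj k d)⁻¹ := by
  have hinv := classConj_classConj k
  constructor
  · rintro ⟨h1, h2, h3⟩
    exact ⟨⟨h1, h2⟩, c, ⟨h1, h2⟩, by rw [h3, inv_inv, sq]⟩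
  · rintro ⟨⟨h1, h2⟩, d, -, hd⟩
    refine ⟨h1, h2, ?_⟩
    have h4 : (classConj k c * c) ^ 2 = 1 := by
      rw [mul_pow, ← map_pow, hd, map_mul, map_inv, hinv]
      group
    have h2' : classConj k c ∈ oddPart (ClassGroup (𝓞 k)) :=
      mem_oddPart.mpr (by rw [MulEquiv.orderOf_eq (classConj k) c]; exact h2)
    have h5 : Odd (orderOf (classConj k c * c)) := mem_oddPart.mp (mul_mem h2' h2)
    have h6 : orderOf (classConj k c * c) = 1 :=
      Nat.Coprime.eq_one_of_dvd (Nat.coprime_two_right.mpr h5) (orderOf_dvd_of_pow_eq_one h4)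
    exact eq_inv_of_mul_eq_one_left (orderOf_eq_one_iff.mp h6)

/-- The group of the 1-cocycles `f : G → M`, with `f (g * h) = g • f h * f g`. -/
def cocycles (G M : Type*) [Group G] [CommGroup M] [MulDistribMulAction G M] :
    Subgroup (G → M) where
  carrier := {f | groupCohomology.IsMulCocycle₁ f}
  one_mem' := fun g h => by simp
  mul_mem' := fun {a b} ha hb g h => by
    simp only [Pi.mul_apply, ha g h, hb g h, smul_mul']
    exact mul_mul_mul_comm _ _ _ _
  inv_mem' := fun {a} ha g h => by
    simp only [Pi.inv_apply, ha g h, smul_inv', mul_inv]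

/-- The subgroup of the 1-coboundaries `g ↦ g • x / x`. -/
def coboundaries (G M : Type*) [Group G] [CommGroup M] [MulDistribMulAction G M] :
    Subgroup (cocycles G M) where
  carrier := {f | groupCohomology.IsMulCoboundary₁ (f : G → M)}
  one_mem' := ⟨1, fun g => by simp⟩
  mul_mem' := by
    rintro a b ⟨x, hx⟩ ⟨y, hy⟩
    exact ⟨x * y, fun g => by
      rw [smul_mul', mul_div_mul_comm, hx, hy]; rfl⟩
  inv_mem' := by
    rintro a ⟨x, hx⟩
    exact ⟨x⁻¹, fun g => by rw [smul_inv', inv_div_inv, ← inv_div, hx]; rfl⟩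

/-- The first cohomology group `H¹(G, M)` of a `G`-module `M`, written multiplicatively. -/
abbrev H1 (G M : Type*) [Group G] [CommGroup M] [MulDistribMulAction G M] :=
  cocycles G M ⧸ coboundaries G M

end Capitulation

end

namespace Capitulation

open scoped Pointwise

/-! The relation `Represents f c` between cocycles and classes is multiplicative, and it is shown to
induce a bijection from the minus part to `H1`. Conjugation inverts roots of unity, so it turns `f`
into `f⁻¹`. A coboundary represents only the trivial class: dividing the generator by a root of
unity makes it Galois-invariant (`Represents.eq_one_of_mem_coboundaries`). Conversely, over the
trivial class the generator is a unit `u` up to a factor from `k`, and `u / conj u` is a root of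
unity whose coboundary is `f ^ 2` (`Represents.mem_coboundaries`). A minus class gets a cocycle by
replacing a generator `β` with an associate of `β ^ 2` of the form `a * β / conj β`, `a` in `k`
(`exists_represents_of_mem`). A cocycle gets a class by Hilbert 90 applied to a square root of it:
the ideal `(β) / (conj β)` comes from `k`, and only here does the ramification hypothesis enter
(`exists_map_mul_eq_map_mul_conj`, `exists_represents`). Even-order roots of unity are removed by
powers of 2, which are invertible on odd-order elements. -/

/-! ### Radicals, ramification and extended ideals -/

theorem radical_map_of_map_eq {R : Type*} [CommRing R] (g : R ≃+* R) {I : Ideal R}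
    (h : I.map g = I) : I.radical.map g = I.radical := by
  have h' : I.comap g.symm = I := (Ideal.map_comap_of_equiv g).symm.trans h
  refine (Ideal.map_comap_of_equiv g).trans ?_
  rw [Ideal.comap_radical, h']

theorem isRadical_of_forall_not_le_sq {R : Type*} [CommRing R] [IsDedekindDomain R]
    {I : Ideal R} (h0 : I ≠ ⊥) (h : ∀ P : Ideal R, P.IsPrime → P ≠ ⊥ → ¬ I ≤ P ^ 2) :
    I.IsRadical := by
  have hsq : Squarefree I := by
    intro X hX
    by_contra hu
    rw [Ideal.isUnit_iff] at hu
    obtain ⟨P, hP, hXP⟩ := Ideal.exists_le_maximal X hu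
    have hIP : I ≤ P ^ 2 := (Ideal.le_of_dvd hX).trans (by
      rw [sq]; exact Ideal.mul_mono hXP hXP)
    refine h P hP.isPrime ?_ hIP
    rintro rfl
    exact h0 (le_bot_iff.mp (hIP.trans (by simp)))
  have := (isRadical_iff_squarefree_of_ne_zero h0).mpr hsq
  intro x hx
  obtain ⟨n, hn⟩ := hx
  rw [← Ideal.span_singleton_le_iff_mem, ← Ideal.dvd_iff_le]
  refine this n _ ?_
  rw [Ideal.dvd_iff_le, Ideal.span_singleton_pow, Ideal.span_singleton_le_iff_mem]
  exact hn

section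
variable {k K : Type*} [Field k] [NumberField k] [Field K] [NumberField K] [Algebra k K]

omit [NumberField k] in
theorem ramificationIdx_ne_one_of_le_sq {P : Ideal (𝓞 K)} [hP : P.IsPrime] (hP0 : P ≠ ⊥)
    (h : (P.under (𝓞 k)).map (algebraMap (𝓞 k) (𝓞 K)) ≤ P ^ 2) :
    P.ramificationIdx (𝓞 k) ≠ 1 := by
  have hp : P.under (𝓞 k) ≠ ⊥ := Ideal.IsIntegral.comap_ne_bot _ hP0
  have hp' : (P.under (𝓞 k)).map (algebraMap (𝓞 k) (𝓞 K)) ≠ ⊥ :=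
    (Ideal.map_eq_bot_iff_of_injective (FaithfulSMul.algebraMap_injective _ _)).not.mpr hp
  rw [Ideal.IsDedekindDomain.ramificationIdx_eq_multiplicity (P.under (𝓞 k)) P hp']
  intro h1
  have hfin : FiniteMultiplicity P ((P.under (𝓞 k)).map (algebraMap (𝓞 k) (𝓞 K))) :=
    FiniteMultiplicity.of_prime_left (Ideal.prime_of_isPrime hP0 hP) hp'
  have := hfin.le_multiplicity_of_pow_dvd (Ideal.dvd_iff_le.mpr h)
  omega

omit [NumberField k] [NumberField K] in
theorem map_algebraMap_smul (σ : Gal(K/k)) (I : Ideal (𝓞 k)) :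
    σ • I.map (algebraMap (𝓞 k) (𝓞 K)) = I.map (algebraMap (𝓞 k) (𝓞 K)) := by
  rw [Ideal.pointwise_smul_def, Ideal.map_map]
  congr 1
  ext x : 1
  exact RingOfIntegers.ext (σ.commutes (x : k))

/-- Holds because extension is already injective on fractional ideals. It descends principality from
`K` to `k`. -/
theorem map_algebraMap_injective :
    Function.Injective (Ideal.map (algebraMap (𝓞 k) (𝓞 K))) := by
  intro I J h
  apply FractionalIdeal.coeIdeal_injective (K := k)
  apply FractionalIdeal.extendedHom_injective (𝓞 k) k K (𝓞 K)
  dsimp only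
  rw [FractionalIdeal.extendedHom_coeIdeal_eq_map, FractionalIdeal.extendedHom_coeIdeal_eq_map, h]

end

/-! ### Complex conjugation and Galois-invariant ideals -/

section
variable {k K : Type*} [Field k] [NumberField k] [IsCMField k]
    [Field K] [NumberField K] [IsCMField K] [Algebra k K]

/-- Any embedding of a CM field into `ℂ` carries its conjugation to that of `ℂ`. -/
theorem complexConj_algebraMap (x : k) :
    complexConj K (algebraMap k K x) = algebraMap k K (complexConj k x) := by
  let φ : K →+* ℂ := Classical.choice inferInstance
  apply φ.injective
  rw [complexEmbedding_complexConj]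
  exact (complexEmbedding_complexConj k (φ.comp (algebraMap k K)) x).symm

omit [NumberField k] [IsCMField k] in
theorem complexConj_algEquiv (σ : Gal(K/k)) (x : K) :
    complexConj K (σ x) = σ (complexConj K x) := by
  let φ : K →+* ℂ := Classical.choice inferInstance
  apply φ.injective
  rw [complexEmbedding_complexConj]
  exact (complexEmbedding_complexConj K (φ.comp (σ : K →+* K)) x).symm

theorem ringOfIntegersComplexConj_algebraMap (x : 𝓞 k) :
    ringOfIntegersComplexConj K (algebraMap (𝓞 k) (𝓞 K) x) =
      algebraMap (𝓞 k) (𝓞 K) (ringOfIntegersComplexConj k x) :=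
  RingOfIntegers.ext (complexConj_algebraMap (x : k))

theorem map_map_ringOfIntegersComplexConj (I : Ideal (𝓞 k)) :
    (I.map (algebraMap (𝓞 k) (𝓞 K))).map (ringOfIntegersComplexConj K) =
      (I.map (ringOfIntegersComplexConj k)).map (algebraMap (𝓞 k) (𝓞 K)) := by
  have h : ((ringOfIntegersComplexConj K : 𝓞 K ≃+* 𝓞 K) : 𝓞 K →+* 𝓞 K).comp
      (algebraMap (𝓞 k) (𝓞 K)) = (algebraMap (𝓞 k) (𝓞 K)).comp
      ((ringOfIntegersComplexConj k : 𝓞 k ≃+* 𝓞 k) : 𝓞 k →+* 𝓞 k) :=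
    RingHom.ext ringOfIntegersComplexConj_algebraMap
  have h2 := congrArg (fun f => I.map f) h
  simp only [← Ideal.map_map] at h2
  exact h2

/-- If conjugation fixes `p`, it fixes the radical. Otherwise the extension of `p` is squarefree, so
the radical is itself extended from `k`. -/
theorem exists_map_mul_radical_eq_map_mul_conj {p : Ideal (𝓞 k)} (hp0 : p ≠ ⊥)
    (hp : p.map (ringOfIntegersComplexConj k) ≠ p → ∀ P : Ideal (𝓞 K), P.IsPrime → P ≠ ⊥ →
      ¬ p.map (algebraMap (𝓞 k) (𝓞 K)) ≤ P ^ 2) :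
    ∃ I J : Ideal (𝓞 k), I ≠ ⊥ ∧ J ≠ ⊥ ∧
      I.map (algebraMap (𝓞 k) (𝓞 K)) * (p.map (algebraMap (𝓞 k) (𝓞 K))).radical =
      J.map (algebraMap (𝓞 k) (𝓞 K)) *
        (p.map (algebraMap (𝓞 k) (𝓞 K))).radical.map (ringOfIntegersComplexConj K) := by
  by_cases hτ : p.map (ringOfIntegersComplexConj k) = p
  · have h : (p.map (algebraMap (𝓞 k) (𝓞 K))).radical.map (ringOfIntegersComplexConj K) =
        (p.map (algebraMap (𝓞 k) (𝓞 K))).radical :=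
      radical_map_of_map_eq (ringOfIntegersComplexConj K).toRingEquiv
        ((map_map_ringOfIntegersComplexConj p).trans (by rw [hτ]))
    exact ⟨⊤, ⊤, top_ne_bot, top_ne_bot, by rw [h]⟩
  · have hA0 : p.map (algebraMap (𝓞 k) (𝓞 K)) ≠ ⊥ :=
      (Ideal.map_eq_bot_iff_of_injective (FaithfulSMul.algebraMap_injective _ _)).not.mpr hp0
    have hr := (isRadical_of_forall_not_le_sq hA0 (hp hτ)).radical
    refine ⟨p.map (ringOfIntegersComplexConj k), p, ?_, hp0, ?_⟩
    · exact (Ideal.map_eq_bot_iff_of_injective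
        (ringOfIntegersComplexConj k).toRingEquiv.injective).not.mpr hp0
    · rw [hr, map_map_ringOfIntegersComplexConj, mul_comm]

/-- An invariant ideal is a product of radicals of extended primes, because Galois permutes the
primes above `p` transitively. The induction splits off one such radical `Q` at a time. -/
theorem exists_map_mul_eq_map_mul_conj [IsGalois k K]
    (hram : ∀ P : Ideal (𝓞 K), P.IsPrime → P ≠ ⊥ → P.ramificationIdx (𝓞 k) ≠ 1 →
      (P.under (𝓞 k)).map (ringOfIntegersComplexConj k) = P.under (𝓞 k))
    (B : Ideal (𝓞 K)) (hB : B ≠ ⊥) (hinv : ∀ σ : Gal(K/k), σ • B = B) :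
    ∃ I J : Ideal (𝓞 k), I ≠ ⊥ ∧ J ≠ ⊥ ∧ I.map (algebraMap (𝓞 k) (𝓞 K)) * B =
      J.map (algebraMap (𝓞 k) (𝓞 K)) * B.map (ringOfIntegersComplexConj K) := by
  induction B using WellFoundedGT.induction with
  | ind B ih =>
  by_cases htop : B = ⊤
  · exact ⟨⊤, ⊤, top_ne_bot, top_ne_bot, by simp [htop, Ideal.map_top]⟩
  obtain ⟨P, hPm, hBP⟩ := Ideal.exists_le_maximal B htop
  have hP : P.IsPrime := hPm.isPrime
  have hP0 : P ≠ ⊥ := fun h => hB (le_bot_iff.mp (h ▸ hBP))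
  set p := P.under (𝓞 k) with hp
  have hp0 : p ≠ ⊥ := Ideal.IsIntegral.comap_ne_bot _ hP0
  have hpm : p.IsMaximal := inferInstance
  set A := p.map (algebraMap (𝓞 k) (𝓞 K)) with hA
  have hA0 : A ≠ ⊥ :=
    (Ideal.map_eq_bot_iff_of_injective (FaithfulSMul.algebraMap_injective _ _)).not.mpr hp0
  have under_eq : ∀ P' : Ideal (𝓞 K), P'.IsPrime → A ≤ P' → P'.under (𝓞 k) = p := by
    intro P' hP' hle
    exact (hpm.eq_of_le (Ideal.IsPrime.ne_top inferInstance) (Ideal.map_le_iff_le_comap.mp hle)).symm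
  set Q := A.radical with hQ
  have hBQ : B ≤ Q := by
    rw [hQ, Ideal.radical_eq_sInf]
    refine le_sInf fun P' ⟨hle, hP'⟩ => ?_
    have : P'.LiesOver p := ⟨(under_eq P' hP' hle).symm⟩
    have : P.LiesOver p := ⟨rfl⟩
    -- One prime above `p` contains the invariant ideal `B`, hence all its conjugates do.
    obtain ⟨σ, rfl⟩ := Ideal.exists_smul_eq_of_isGaloisGroup p P P' Gal(K/k)
    rw [← hinv σ]
    exact Ideal.pointwise_smul_le_pointwise_smul_iff.mpr hBP
  have hQP : Q ≤ P := by
    rw [hQ, Ideal.IsPrime.radical_le_iff hP]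
    exact Ideal.map_comap_le
  have hQ0 : Q ≠ ⊥ := fun h => hB (le_bot_iff.mp (h ▸ hBQ))
  have hQinv : ∀ σ : Gal(K/k), σ • Q = Q := fun σ =>
    radical_map_of_map_eq (MulSemiringAction.toRingEquiv _ (𝓞 K) σ) (map_algebraMap_smul σ p)
  have hQconj := exists_map_mul_radical_eq_map_mul_conj (K := K) (p := p) hp0 fun hτ P' hP' hle =>
    fun h2 => hτ (by
      have h1 := under_eq P' hP' (h2.trans (Ideal.pow_le_self two_ne_zero))
      rw [← h1]
      exact hram P' hP' hle (ramificationIdx_ne_one_of_le_sq hle (by rwa [h1])))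
  obtain ⟨B', rfl⟩ := Ideal.dvd_iff_le.mpr hBQ
  have hB'0 : B' ≠ ⊥ := by rintro rfl; simp at hB
  obtain ⟨I, J, hI, hJ, hIJ⟩ := hQconj
  obtain ⟨I', J', hI', hJ', hIJ'⟩ := ih B' (by
      refine lt_of_le_of_ne Ideal.mul_le_right fun h => ?_
      have h2 : Q * B' = 1 * B' := by rw [one_mul]; exact h
      have h3 : Q = ⊤ := (mul_right_cancel₀ hB'0 h2).trans Ideal.one_eq_top
      exact hP.ne_top (top_le_iff.mp (h3 ▸ hQP))) hB'0 (fun σ => by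
      have h := hinv σ
      rw [Ideal.pointwise_smul_def, Ideal.map_mul, ← Ideal.pointwise_smul_def,
        ← Ideal.pointwise_smul_def, hQinv] at h
      exact mul_left_cancel₀ hQ0 h)
  refine ⟨I * I', J * J', mul_ne_zero hI hI', mul_ne_zero hJ hJ', ?_⟩
  rw [Ideal.map_mul, Ideal.map_mul, Ideal.map_mul, mul_mul_mul_comm, hIJ, hIJ', mul_mul_mul_comm]

end
-- Odd order and roots of unity
theorem mem_of_pow_two_pow_mem {M : Type*} [Group M] (H : Subgroup M) {x : M}
    (hx : Odd (orderOf x)) {j : ℕ} (h : x ^ 2 ^ j ∈ H) : x ∈ H := by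
  obtain ⟨m, hm⟩ := exists_pow_eq_self_of_coprime
    (Nat.Coprime.pow_left j (Nat.coprime_two_left.mpr hx))
  exact hm ▸ pow_mem h m

theorem odd_orderOf_cocycles {G M : Type*} [Group G] [Finite G] [CommGroup M]
    [MulDistribMulAction G M] (f : cocycles G (oddPart M)) : Odd (orderOf f) := by
  have := Fintype.ofFinite G
  have hn : Odd (∏ g, orderOf ((f : G → oddPart M) g)) :=
    Finset.prod_induction _ Odd (fun _ _ => Odd.mul) odd_one fun g _ => by
      rw [← Subgroup.orderOf_coe]; exact ((f : G → oddPart M) g).2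
  refine hn.of_dvd_nat (orderOf_dvd_of_pow_eq_one (Subtype.ext (funext fun g => ?_)))
  exact orderOf_dvd_iff_pow_eq_one.mp (Finset.dvd_prod_of_mem _ (Finset.mem_univ g))

section
variable {K : Type*} [Field K] [NumberField K]

theorem odd_orderOf_torsion_pow :
    ∃ j : ℕ, ∀ ζ : Units.torsion K, Odd (orderOf (ζ ^ 2 ^ j)) := by
  -- `2 ^ j` is the 2-part of the number of roots of unity.
  obtain ⟨j, m, hm, h⟩ := Nat.exists_eq_two_pow_mul_odd (Units.torsionOrder_ne_zero K)
  refine ⟨j, fun ζ => hm.of_dvd_nat (orderOf_dvd_of_pow_eq_one ?_)⟩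
  rw [← pow_mul, ← h]
  exact pow_card_eq_one'

omit [NumberField K] in
theorem coe_mul (x y : 𝓞 K) : ((x * y : 𝓞 K) : K) = x * y :=
  map_mul (algebraMap (𝓞 K) K) x y

omit [NumberField K] in
theorem coe_pow (x : 𝓞 K) (n : ℕ) : ((x ^ n : 𝓞 K) : K) = (x : K) ^ n :=
  map_pow (algebraMap (𝓞 K) K) x n

omit [NumberField K] in
theorem exists_units_coe_eq {x : Kˣ} (hx : IsOfFinOrder x) : ∃ u : (𝓞 K)ˣ, ((u : 𝓞 K) : K) = x := by
  have hint : ∀ y : Kˣ, IsOfFinOrder y → IsIntegral ℤ (y : K) := fun y hy => by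
    obtain ⟨n, hn, h⟩ := isOfFinOrder_iff_pow_eq_one.mp hy
    refine IsIntegral.of_pow hn ?_
    rw [← Units.val_pow_eq_pow_val, h]
    exact isIntegral_one
  exact ⟨⟨⟨x, hint x hx⟩, ⟨(x⁻¹ : Kˣ), hint _ hx.inv⟩, RingOfIntegers.ext x.mul_inv,
    RingOfIntegers.ext x.inv_mul⟩, rfl⟩

theorem isOfFinOrder_of_mem_oddPart {M : Type*} [CommGroup M] {x : M} (hx : x ∈ oddPart M) :
    IsOfFinOrder x :=
  orderOf_pos_iff.mp (Odd.pos hx)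

theorem complexConj_of_isOfFinOrder [IsCMField K] {x : Kˣ} (hx : IsOfFinOrder x) :
    complexConj K (x : K) = (x : K)⁻¹ := by
  obtain ⟨u, hu⟩ := exists_units_coe_eq hx
  have ht : u ∈ Units.torsion K := by
    obtain ⟨n, hn, h⟩ := isOfFinOrder_iff_pow_eq_one.mp hx
    refine isOfFinOrder_iff_pow_eq_one.mpr ⟨n, hn, Units.ext (RingOfIntegers.ext ?_)⟩
    rw [Units.val_pow_eq_pow_val, coe_pow, hu, ← Units.val_pow_eq_pow_val, h]
    simp
  rw [← hu]
  exact complexConj_torsion K ⟨u, ht⟩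

theorem complexConj_oddPart [IsCMField K] (x : oddPart Kˣ) :
    complexConj K ((x : Kˣ) : K) = ((x : Kˣ) : K)⁻¹ :=
  complexConj_of_isOfFinOrder (isOfFinOrder_of_mem_oddPart x.2)

end

/-! ### The relation between cocycles and classes -/

section
variable {k K : Type*} [Field k] [NumberField k] [Field K] [NumberField K] [Algebra k K]

/-- The class `c` contains an integral ideal whose extension to `K` has a generator `β` with
`σ β = f σ * β` for all `σ`. -/
def Represents (f : cocycles Gal(K/k) (oddPart Kˣ)) (c : ClassGroup (𝓞 k)) : Prop :=
  ∃ (I : (Ideal (𝓞 k))⁰) (β : 𝓞 K), ClassGroup.mk0 I = c ∧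
    (I : Ideal (𝓞 k)).map (algebraMap (𝓞 k) (𝓞 K)) = Ideal.span {β} ∧
    ∀ σ : Gal(K/k), σ (β : K) = (((f : Gal(K/k) → oddPart Kˣ) σ : Kˣ) : K) * (β : K)

omit [NumberField k] [NumberField K] in
theorem generator_ne_zero {I : (Ideal (𝓞 k))⁰} {β : 𝓞 K}
    (h : (I : Ideal (𝓞 k)).map (algebraMap (𝓞 k) (𝓞 K)) = Ideal.span {β}) : β ≠ 0 := by
  rintro rfl
  rw [Ideal.span_singleton_eq_bot.mpr rfl,
    Ideal.map_eq_bot_iff_of_injective (FaithfulSMul.algebraMap_injective _ _)] at h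
  exact nonZeroDivisors.ne_zero I.2 h

omit [NumberField k] [NumberField K] in
theorem isMulCocycle₁_of_mul_eq {f : Gal(K/k) → oddPart Kˣ} {x : K} (hx : x ≠ 0)
    (h : ∀ σ, σ x = ((f σ : Kˣ) : K) * x) : groupCohomology.IsMulCocycle₁ f := by
  intro σ τ
  refine Subtype.ext (Units.ext (mul_right_cancel₀ hx ?_))
  rw [← h, AlgEquiv.mul_apply, h τ, map_mul, h σ, ← mul_assoc]
  rfl

omit [NumberField K] in
theorem Represents.one : Represents (1 : cocycles Gal(K/k) (oddPart Kˣ)) 1 :=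
  ⟨1, 1, map_one _, by simp [Ideal.one_eq_top, Ideal.map_top], fun σ => by simp⟩

omit [NumberField K] in
theorem Represents.mul {f f' : cocycles Gal(K/k) (oddPart Kˣ)} {c c' : ClassGroup (𝓞 k)}
    (h : Represents f c) (h' : Represents f' c') : Represents (f * f') (c * c') := by
  obtain ⟨I, β, rfl, hI, hβ⟩ := h
  obtain ⟨I', β', rfl, hI', hβ'⟩ := h'
  refine ⟨I * I', β * β', map_mul _ _ _, ?_, fun σ => ?_⟩
  · rw [Submonoid.coe_mul, Ideal.map_mul, hI, hI', Ideal.span_singleton_mul_span_singleton]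
  · simp only [map_mul, hβ, hβ', Subgroup.coe_mul, Pi.mul_apply, Units.val_mul]
    ring

omit [NumberField K] in
theorem Represents.pow {f : cocycles Gal(K/k) (oddPart Kˣ)} {c : ClassGroup (𝓞 k)}
    (h : Represents f c) (n : ℕ) : Represents (f ^ n) (c ^ n) := by
  induction n with
  | zero => simpa using Represents.one
  | succ n ih => simpa only [pow_succ] using ih.mul h

theorem Represents.eq_one_of_mem_coboundaries [IsGalois k K]
    {f : cocycles Gal(K/k) (oddPart Kˣ)} {c : ClassGroup (𝓞 k)}
    (h : Represents f c) (hf : f ∈ coboundaries Gal(K/k) (oddPart Kˣ)) : c = 1 := by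
  obtain ⟨I, β, rfl, hI, hβ⟩ := h
  obtain ⟨x, hx⟩ := hf
  obtain ⟨u, hu⟩ := exists_units_coe_eq (isOfFinOrder_of_mem_oddPart x.2)
  -- The root of unity `u` has the same coboundary as `β`, so the quotient lies in `𝓞 k`.
  have hfix : ∀ σ : Gal(K/k), σ • (β * ↑u⁻¹ : 𝓞 K) = β * ↑u⁻¹ := by
    intro σ
    have h1 : σ (x : Kˣ) = (((f : Gal(K/k) → oddPart Kˣ) σ : Kˣ) : K) * ((x : Kˣ) : K) := by
      have := congrArg (fun y : oddPart Kˣ => ((y : Kˣ) : K)) (div_eq_iff_eq_mul.mp (hx σ))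
      exact this
    have hu' : (((u⁻¹ : (𝓞 K)ˣ) : 𝓞 K) : K) = ((x : Kˣ) : K)⁻¹ := by
      rw [← hu]; simp
    apply RingOfIntegers.ext
    change σ ((β * ↑u⁻¹ : 𝓞 K) : K) = _
    rw [coe_mul, map_mul, hu', map_inv₀, hβ, h1]
    field_simp
  obtain ⟨b, hb⟩ := Algebra.IsInvariant.isInvariant (A := 𝓞 k) _ hfix
  refine (ClassGroup.mk0_eq_one_iff I.2).mpr ⟨b, map_algebraMap_injective (K := K) ?_⟩
  rw [hI, Ideal.submodule_span_eq, Ideal.map_span, Set.image_singleton, hb,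
    Ideal.span_singleton_eq_span_singleton]
  exact ⟨u⁻¹, rfl⟩

end

/-! ### Conjugation and the units `u / conj u` -/

section
variable {k K : Type*} [Field k] [NumberField k] [IsCMField k]
    [Field K] [NumberField K] [IsCMField K] [Algebra k K]

theorem Represents.conj {f : cocycles Gal(K/k) (oddPart Kˣ)} {c : ClassGroup (𝓞 k)}
    (h : Represents f c) : Represents f⁻¹ (classConj k c) := by
  obtain ⟨I, β, rfl, hI, hβ⟩ := h
  have h0 : (I : Ideal (𝓞 k)).map (ringOfIntegersComplexConj k).toRingEquiv ∈ (Ideal (𝓞 k))⁰ := by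
    rw [mem_nonZeroDivisors_iff_ne_zero]
    exact (Ideal.map_eq_bot_iff_of_injective
      (ringOfIntegersComplexConj k).toRingEquiv.injective).not.mpr
      (nonZeroDivisors.ne_zero I.2)
  refine ⟨⟨_, h0⟩, ringOfIntegersComplexConj K β, (mulEquiv_mk0 _ _ _ rfl).symm, ?_, fun σ => ?_⟩
  · refine (map_map_ringOfIntegersComplexConj (K := K) (I : Ideal (𝓞 k))).symm.trans ?_
    rw [hI, Ideal.map_span, Set.image_singleton]
  · rw [coe_ringOfIntegersComplexConj, ← complexConj_algEquiv, hβ, map_mul,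
      complexConj_oddPart]
    simp

theorem Represents.mem_oddCapMinus [IsGalois k K]
    {f : cocycles Gal(K/k) (oddPart Kˣ)} {c : ClassGroup (𝓞 k)}
    (h : Represents f c) : c ∈ oddCapMinus k K := by
  refine ⟨?_, ?_, ?_⟩
  · obtain ⟨I, β, rfl, hI, -⟩ := h
    rw [cap, MonoidHom.mem_ker, ClassGroup.extendedHom_mk0, ClassGroup.mk0_eq_one_iff]
    exact ⟨β, hI⟩
  -- The trivial cocycle represents only the trivial class, so the order of `c` divides that of `f`.
  · have h1 := h.pow (orderOf f)
    rw [pow_orderOf_eq_one] at h1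
    exact (odd_orderOf_cocycles f).of_dvd_nat
      (orderOf_dvd_of_pow_eq_one (h1.eq_one_of_mem_coboundaries (one_mem _)))
  · have h1 := h.conj.mul h
    rw [inv_mul_cancel] at h1
    exact eq_inv_of_mul_eq_one_left (h1.eq_one_of_mem_coboundaries (one_mem _))

/-- For a unit `u`, the root of unity `u / conj u`, as an element of `Kˣ`. -/
noncomputable def unitsDivConj : (𝓞 K)ˣ →* Kˣ :=
  (Units.map (algebraMap (𝓞 K) K).toMonoidHom).comp
    ((Units.torsion K).subtype.comp (unitsMulComplexConjInv K))

theorem coe_unitsDivConj (u : (𝓞 K)ˣ) :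
    (unitsDivConj u : K) = ((u : 𝓞 K) : K) / complexConj K ((u : 𝓞 K) : K) := by
  simp [unitsDivConj, unitsMulComplexConjInv_apply, div_eq_mul_inv]

theorem exists_unitsDivConj_pow_mem_oddPart :
    ∃ j : ℕ, ∀ u : (𝓞 K)ˣ, unitsDivConj u ^ 2 ^ j ∈ oddPart Kˣ := by
  obtain ⟨j, hj⟩ := odd_orderOf_torsion_pow (K := K)
  refine ⟨j, fun u => ?_⟩
  have := orderOf_map_dvd ((Units.map (algebraMap (𝓞 K) K).toMonoidHom).comp
    (Units.torsion K).subtype) (unitsMulComplexConjInv K u ^ 2 ^ j)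
  rw [map_pow] at this
  exact (hj _).of_dvd_nat this

omit [IsCMField k] in
theorem Represents.mem_coboundaries {f : cocycles Gal(K/k) (oddPart Kˣ)}
    (h : Represents f 1) : f ∈ coboundaries Gal(K/k) (oddPart Kˣ) := by
  obtain ⟨I, β, hI1, hI, hβ⟩ := h
  obtain ⟨a, ha⟩ := (ClassGroup.mk0_eq_one_iff I.2).mp hI1
  rw [Ideal.submodule_span_eq] at ha
  have hβ0 := generator_ne_zero hI
  rw [ha, Ideal.map_span, Set.image_singleton, Ideal.span_singleton_eq_span_singleton] at hI
  obtain ⟨u, hu⟩ := hI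
  have ha0 : algebraMap (𝓞 k) (𝓞 K) a ≠ 0 := by
    intro h0
    exact hβ0 (by rw [← hu, h0, zero_mul])
  have hσu : ∀ σ : Gal(K/k), σ ((u : 𝓞 K) : K) =
      (((f : Gal(K/k) → oddPart Kˣ) σ : Kˣ) : K) * ((u : 𝓞 K) : K) := by
    intro σ
    have h1 := hβ σ
    have h2 : σ (algebraMap (𝓞 k) (𝓞 K) a : K) = (algebraMap (𝓞 k) (𝓞 K) a : K) :=
      σ.commutes (a : k)
    rw [← hu, coe_mul, map_mul, h2, mul_left_comm] at h1
    exact mul_left_cancel₀ (RingOfIntegers.coe_ne_zero_iff.mpr ha0) h1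
  obtain ⟨j, hj⟩ := exists_unitsDivConj_pow_mem_oddPart (K := K)
  -- The exponent `j + 1` counts `j` squarings to reach odd order and one from `u / conj u`, whose
  -- coboundary is `f ^ 2`.
  suffices h : f ^ 2 ^ (j + 1) ∈ coboundaries Gal(K/k) (oddPart Kˣ) from
    mem_of_pow_two_pow_mem _ (odd_orderOf_cocycles f) h
  refine ⟨⟨unitsDivConj u ^ 2 ^ j, hj u⟩, fun σ => ?_⟩
  rw [div_eq_iff_eq_mul']
  refine Subtype.ext (Units.ext ?_)
  have h1 : σ (unitsDivConj u : K) =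
      (((f : Gal(K/k) → oddPart Kˣ) σ : Kˣ) : K) ^ 2 * (unitsDivConj u : K) := by
    rw [coe_unitsDivConj, map_div₀, ← complexConj_algEquiv, hσu, map_mul,
      complexConj_oddPart]
    field_simp
  change σ ((unitsDivConj u ^ 2 ^ j : Kˣ) : K) = ((unitsDivConj u ^ 2 ^ j : Kˣ) : K) *
    (((f : Gal(K/k) → oddPart Kˣ) σ : Kˣ) : K) ^ 2 ^ (j + 1)
  rw [Units.val_pow_eq_pow_val, map_pow, h1, mul_pow, ← pow_mul, ← pow_succ', mul_comm]

end
-- Existence of cocycles and of classes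
variable {k K : Type*} [Field k] [NumberField k] [IsCMField k]
    [Field K] [NumberField K] [IsCMField K] [Algebra k K]

theorem exists_represents_of_mem {c : ClassGroup (𝓞 k)} (hc : c ∈ oddCapMinus k K) :
    ∃ f : cocycles Gal(K/k) (oddPart Kˣ), Represents f c := by
  obtain ⟨j, hj⟩ := exists_unitsDivConj_pow_mem_oddPart (K := K)
  suffices h : ∃ f : cocycles Gal(K/k) (oddPart Kˣ), Represents f (c ^ 2 ^ (j + 1)) by
    obtain ⟨f, hf⟩ := h
    obtain ⟨m, hm⟩ := exists_pow_eq_self_of_coprime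
      (Nat.Coprime.pow_left (j + 1) (Nat.coprime_two_left.mpr (mem_oddPart.mp hc.2.1)))
    exact ⟨f ^ m, hm ▸ hf.pow m⟩
  obtain ⟨h1, -, h3⟩ := hc
  obtain ⟨I, rfl⟩ := ClassGroup.mk0_surjective c
  rw [cap, MonoidHom.mem_ker, ClassGroup.extendedHom_mk0, ClassGroup.mk0_eq_one_iff] at h1
  obtain ⟨β, hβ⟩ := h1
  rw [Ideal.submodule_span_eq] at hβ
  have hβ0 := generator_ne_zero hβ
  have h0 : (I : Ideal (𝓞 k)).map (ringOfIntegersComplexConj k).toRingEquiv ∈ (Ideal (𝓞 k))⁰ := by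
    rw [mem_nonZeroDivisors_iff_ne_zero]
    exact (Ideal.map_eq_bot_iff_of_injective
      (ringOfIntegersComplexConj k).toRingEquiv.injective).not.mpr (nonZeroDivisors.ne_zero I.2)
  rw [classConj, mulEquiv_mk0 _ I ⟨_, h0⟩ rfl, eq_inv_iff_mul_eq_one, ← map_mul,
    ← Subtype.coe_eta (_ * I) (Subtype.prop _), ClassGroup.mk0_eq_one_iff] at h3
  obtain ⟨a, ha⟩ := h3
  rw [Ideal.submodule_span_eq, Submonoid.coe_mul] at ha
  replace ha := congrArg (Ideal.map (algebraMap (𝓞 k) (𝓞 K))) ha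
  rw [Ideal.map_mul] at ha
  have hτ := map_map_ringOfIntegersComplexConj (K := K) (I : Ideal (𝓞 k))
  rw [hβ, Ideal.map_span, Set.image_singleton] at hτ
  replace ha := (congrArg₂ (· * ·) hτ hβ.symm).trans ha
  rw [Ideal.map_span, Set.image_singleton, Ideal.span_singleton_mul_span_singleton,
    Ideal.span_singleton_eq_span_singleton] at ha
  obtain ⟨u, hu⟩ := ha
  set τ := complexConj K with hτdef
  have hβK : (β : K) ≠ 0 := RingOfIntegers.coe_ne_zero_iff.mpr hβ0
  have hτβK : τ (β : K) ≠ 0 := (map_ne_zero τ).mpr hβK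
  -- The minus condition makes the norm of `I` to the real subfield, extended to `k`, principal with
  -- generator `a`; hence `β * τ β * u = a`.
  have hδ : ((β ^ 2 * u : 𝓞 K) : K) * τ β = algebraMap k K a * β := by
    have := congrArg (fun x : 𝓞 K => (x : K)) hu
    have h' : ((algebraMap (𝓞 k) (𝓞 K) a : 𝓞 K) : K) = algebraMap k K a := rfl
    simp only [coe_mul, coe_ringOfIntegersComplexConj, h'] at this
    rw [← this, coe_mul, coe_pow]
    ring
  have hunit : ∀ σ : Gal(K/k), ∃ v : (𝓞 K)ˣ, σ (β : K) = ((v : 𝓞 K) : K) * β := by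
    intro σ
    have h := map_algebraMap_smul σ (I : Ideal (𝓞 k)) (K := K)
    rw [hβ, Ideal.pointwise_smul_def, Ideal.map_span, Set.image_singleton, eq_comm,
      Ideal.span_singleton_eq_span_singleton] at h
    obtain ⟨v, hv⟩ := h
    refine ⟨v, ?_⟩
    rw [mul_comm, ← coe_mul, hv]
    rfl
  choose v hv using hunit
  set δ : 𝓞 K := β ^ 2 * u with hδdef
  have hδ0 : δ ≠ 0 := mul_ne_zero (pow_ne_zero _ hβ0) u.ne_zero
  -- Since `δ = a * β / τ β` and `σ` fixes `a`, the unit `v σ` enters only through its quotient by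
  -- its conjugate.
  have hδσ : ∀ σ : Gal(K/k), σ (δ : K) = (unitsDivConj (v σ) : K) * δ := by
    intro σ
    have h := congrArg σ hδ
    rw [map_mul, map_mul, AlgEquiv.commutes, ← complexConj_algEquiv, hv, map_mul] at h
    have hv0 : complexConj K ((v σ : 𝓞 K) : K) ≠ 0 :=
      (map_ne_zero τ).mpr (RingOfIntegers.coe_ne_zero_iff.mpr (v σ).ne_zero)
    rw [coe_unitsDivConj]
    rw [div_mul_eq_mul_div, eq_div_iff hv0]
    refine mul_right_cancel₀ hτβK ?_
    linear_combination h - ((v σ : 𝓞 K) : K) * hδ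
  have hδK : ((δ ^ 2 ^ j : 𝓞 K) : K) ≠ 0 :=
    RingOfIntegers.coe_ne_zero_iff.mpr (pow_ne_zero _ hδ0)
  have hf : ∀ σ : Gal(K/k), σ ((δ ^ 2 ^ j : 𝓞 K) : K) =
      ((unitsDivConj (v σ) ^ 2 ^ j : Kˣ) : K) * ((δ ^ 2 ^ j : 𝓞 K) : K) := by
    intro σ
    rw [coe_pow, map_pow, hδσ, mul_pow, Units.val_pow_eq_pow_val]
  let f : Gal(K/k) → oddPart Kˣ := fun σ => ⟨unitsDivConj (v σ) ^ 2 ^ j, hj _⟩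
  have hfc : groupCohomology.IsMulCocycle₁ f := isMulCocycle₁_of_mul_eq hδK hf
  refine ⟨⟨f, hfc⟩,
    I ^ 2 ^ (j + 1), δ ^ 2 ^ j, map_pow _ _ _, ?_, hf⟩
  rw [SubmonoidClass.coe_pow, Ideal.map_pow, hβ, Ideal.span_singleton_pow,
    Ideal.span_singleton_eq_span_singleton]
  refine ⟨u ^ 2 ^ j, ?_⟩
  rw [hδdef, mul_pow, ← pow_mul, ← pow_succ', Units.val_pow_eq_pow_val]

theorem exists_represents [IsGalois k K]
    (hram : ∀ P : Ideal (𝓞 K), P.IsPrime → P ≠ ⊥ → P.ramificationIdx (𝓞 k) ≠ 1 →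
      (P.under (𝓞 k)).map (ringOfIntegersComplexConj k) = P.under (𝓞 k))
    (f : cocycles Gal(K/k) (oddPart Kˣ)) : ∃ c : ClassGroup (𝓞 k), Represents f c := by
  -- The square root compensates for `β / conj β`, whose coboundary is the square of that of `β`.
  obtain ⟨g, rfl⟩ : ∃ g, g ^ 2 = f := by
    obtain ⟨m, hm⟩ := exists_pow_eq_self_of_coprime
      (Nat.coprime_two_left.mpr (odd_orderOf_cocycles f))
    exact ⟨f ^ m, by rw [← pow_mul, mul_comm, pow_mul, hm]⟩
  let g' : Gal(K/k) → oddPart Kˣ := g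
  obtain ⟨x, hx⟩ := groupCohomology.isMulCoboundary₁_of_isMulCocycle₁_of_aut_to_units
    (fun σ => ((g' σ : oddPart Kˣ) : Kˣ))
    (fun σ τ => congrArg (Subtype.val : oddPart Kˣ → Kˣ) (g.2 σ τ))
  have hxσ : ∀ σ : Gal(K/k), σ (x : K) = ((g' σ : Kˣ) : K) * x := fun σ =>
    congrArg (Units.val : Kˣ → K) (div_eq_iff_eq_mul.mp (hx σ))
  obtain ⟨n, hn, hint⟩ := IsAlgebraic.exists_integral_multiple
    ((IsFractionRing.isAlgebraic_iff ℤ ℚ K).mpr (Algebra.IsAlgebraic.isAlgebraic (x : K)))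
  let β : 𝓞 K := ⟨n • (x : K), hint⟩
  have hβK : (β : K) ≠ 0 := smul_ne_zero hn x.ne_zero
  have hβ0 : β ≠ 0 := RingOfIntegers.coe_ne_zero_iff.mp hβK
  have hβ : ∀ σ : Gal(K/k), σ (β : K) = ((g' σ : Kˣ) : K) * β := by
    intro σ
    change σ (n • (x : K)) = _ * (n • (x : K))
    rw [map_zsmul, hxσ, mul_smul_comm]
  obtain ⟨I, J, hI, hJ, hIJ⟩ := exists_map_mul_eq_map_mul_conj hram (Ideal.span {β})
    (by simpa using hβ0) (fun σ => by
      obtain ⟨u, hu⟩ := exists_units_coe_eq (isOfFinOrder_of_mem_oddPart (g' σ).2)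
      rw [Ideal.pointwise_smul_def, Ideal.map_span, Set.image_singleton, eq_comm,
        Ideal.span_singleton_eq_span_singleton]
      refine ⟨u, RingOfIntegers.ext ?_⟩
      rw [coe_mul, hu, mul_comm]
      exact (hβ σ).symm)
  rw [Ideal.map_span, Set.image_singleton] at hIJ
  -- Multiplying by an ideal `I'` with `I' * I = (b)` clears `I`, so that `γ = b * β / conj β` is
  -- integral and generates the extension of `I' * J`.
  obtain ⟨I', hI'⟩ := ClassGroup.mk0_surjective
    (ClassGroup.mk0 ⟨I, mem_nonZeroDivisors_of_ne_zero hI⟩)⁻¹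
  rw [eq_inv_iff_mul_eq_one, ← map_mul, ← Subtype.coe_eta (I' * _) (Subtype.prop _),
    ClassGroup.mk0_eq_one_iff] at hI'
  obtain ⟨b, hb⟩ := hI'
  rw [Ideal.submodule_span_eq, Submonoid.coe_mul] at hb
  change (I' : Ideal (𝓞 k)) * I = _ at hb
  have hb0 : algebraMap (𝓞 k) (𝓞 K) b ≠ 0 := by
    intro h0
    rw [FaithfulSMul.algebraMap_eq_zero_iff] at h0
    rw [h0, Ideal.span_singleton_eq_bot.mpr rfl] at hb
    exact mul_ne_zero (nonZeroDivisors.ne_zero I'.2) hI hb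
  have key : Ideal.span {algebraMap (𝓞 k) (𝓞 K) b * β} =
      ((I' : Ideal (𝓞 k)) * J).map (algebraMap (𝓞 k) (𝓞 K)) *
        Ideal.span {ringOfIntegersComplexConj K β} := by
    rw [← Ideal.span_singleton_mul_span_singleton, ← Set.image_singleton, ← Ideal.map_span, ← hb,
      Ideal.map_mul, mul_assoc, hIJ, Ideal.map_mul, mul_assoc]
  obtain ⟨γ, hγ⟩ : ringOfIntegersComplexConj K β ∣ algebraMap (𝓞 k) (𝓞 K) b * β := by
    rw [← Ideal.mem_span_singleton, ← Ideal.span_singleton_le_iff_mem, key]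
    exact Ideal.mul_le_right
  have hτβ0 : ringOfIntegersComplexConj K β ≠ 0 :=
    (map_ne_zero_iff _ (ringOfIntegersComplexConj K).injective).mpr hβ0
  refine ⟨_, I' * ⟨J, mem_nonZeroDivisors_of_ne_zero hJ⟩, γ, rfl, ?_, fun σ => ?_⟩
  · rw [hγ, mul_comm, ← Ideal.span_singleton_mul_span_singleton] at key
    exact (mul_right_cancel₀ (by simpa using hτβ0) key).symm
  · have h1 : algebraMap k K b * β = complexConj K β * γ := by
      have := congrArg (fun x : 𝓞 K => (x : K)) hγ
      simp only [coe_mul] at this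
      exact this
    have h2 := congrArg σ h1
    rw [map_mul, map_mul, AlgEquiv.commutes, ← complexConj_algEquiv, hβ, map_mul,
      complexConj_oddPart] at h2
    have hτβK : complexConj K (β : K) ≠ 0 := (map_ne_zero _).mpr hβK
    have hg0 : ((g' σ : Kˣ) : K) ≠ 0 := Units.ne_zero _
    change σ (γ : K) = ((g' σ : Kˣ) : K) ^ 2 * γ
    refine mul_left_cancel₀ hτβK ?_
    field_simp at h2
    linear_combination -h2 + ((g' σ : Kˣ) : K) ^ 2 * h1

end Capitulation

/-! ### The isomorphism -/

open Capitulation in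
theorem mainTheorem11 (k K : Type*) [Field k] [NumberField k] [IsCMField k]
    [Field K] [NumberField K] [IsCMField K] [Algebra k K] [IsGalois k K]
    (hram : ∀ P : Ideal (𝓞 K), P.IsPrime → P ≠ ⊥ → P.ramificationIdx (𝓞 k) ≠ 1 →
      (P.under (𝓞 k)).map (ringOfIntegersComplexConj k) = P.under (𝓞 k)) :
    ∃ e : oddCapMinus k K ≃* H1 Gal(K/k) (oddPart Kˣ),
      ∀ c : oddCapMinus k K, ∃ (I : (Ideal (𝓞 k))⁰) (β : 𝓞 K)
        (f : cocycles Gal(K/k) (oddPart Kˣ)),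
        ClassGroup.mk0 I = (c : ClassGroup (𝓞 k)) ∧
        (I : Ideal (𝓞 k)).map (algebraMap (𝓞 k) (𝓞 K)) = Ideal.span {β} ∧
        (∀ σ : Gal(K/k), σ (β : K) = (((f : Gal(K/k) → oddPart Kˣ) σ : Kˣ) : K) * (β : K)) ∧
        e c = QuotientGroup.mk f := by
  choose F hF using fun c : oddCapMinus k K => exists_represents_of_mem c.2
  have huniq : ∀ (f : cocycles Gal(K/k) (oddPart Kˣ)) (c : oddCapMinus k K),
      Represents f (c : ClassGroup (𝓞 k)) →
      (QuotientGroup.mk (F c) : H1 Gal(K/k) (oddPart Kˣ)) = QuotientGroup.mk f := by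
    intro f c hf
    -- Conjugation sends `c` to its inverse, so `(F c)⁻¹ * f` represents the trivial class.
    have h := (hF c).conj.mul hf
    rw [c.2.2.2, inv_mul_cancel] at h
    exact QuotientGroup.eq.mpr h.mem_coboundaries
  let φ : oddCapMinus k K →* H1 Gal(K/k) (oddPart Kˣ) :=
    MonoidHom.mk' (fun c => QuotientGroup.mk (F c)) fun c d =>
      huniq (F c * F d) (c * d) ((hF c).mul (hF d))
  have hφ : Function.Bijective φ := by
    constructor
    · refine (injective_iff_map_eq_one φ).mpr fun c hc => Subtype.ext ?_
      exact (hF c).eq_one_of_mem_coboundaries ((QuotientGroup.eq_one_iff _).mp hc)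
    · intro y
      obtain ⟨f, rfl⟩ := QuotientGroup.mk_surjective y
      obtain ⟨c, hc⟩ := exists_represents hram f
      exact ⟨⟨c, hc.mem_oddCapMinus⟩, huniq f _ hc⟩
  refine ⟨MulEquiv.ofBijective φ hφ, fun c => ?_⟩
  obtain ⟨I, β, h1, h2, h3⟩ := hF c
  exact ⟨I, β, F c, h1, h2, h3, rfl⟩
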